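/- **Setting.** A *linear symmetric hedge algebra* consists of a partially ordered set $X$ of terms, two primary terms $c^-<c^+$ (False, True) and a set $H$ of hedges (unary operations on $X$) satisfying the usual hedge algebra axioms, such that every element of $X$ has the form $h_n\cdots h_1c$ with $c\in\{c^-,c^+\}$, every element $x$ has exactly one contradictory element $\overline{x}$ (obtained by exchanging $c^-$ and $c^+$ in a canonical representation of $x$), $H$ is the disjoint union of $H^+=\{h: hc^+>c^+\}$ and $H^-=\{h: hc^+<c^+\}$, and $H^+$ and $H^-$ are linearly ordered. Its truth domain is the linearly ordered set $\overline X=X\cup\{\bot,W,\top\}$, where $\bot$ is the least and $\top$ the greatest element and $W$ lies above all terms generated from $c^-$ and below all terms generated from $c^+$. Put $\alpha\wedge\beta=\min(\alpha,\beta)$, $\alpha\vee\beta=\max(\alpha,\beta)$, $\neg x=\overline x$ for $x\in X$, $\neg\bot=\top$, $\neg\top=\bot$, $\neg W=W$. A *literal* is $P^{a}$ with $P$ an atom of a first-order language and $a\in\overline X\setminus\{W\}$. A *clause* is a finite set (disjunction) of literals; $\Box$ is the empty clause. A *clause set* is a set of pairs $(C,\alpha)$ of a clause $C$ and a reliability $\alpha\in\overline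 X$, $\alpha>W$. An *interpretation* has a non-empty domain $D$, interprets $n$-ary function symbols by maps $D^n\to D$ and $n$-ary predicate symbols by maps $D^n\to\overline X\setminus\{W\}$. If the atom $P$ has value $\alpha_1$ (under an assignment of the variables), then $P^{\alpha_2}$ has the value $$\begin{cases}\alpha_1\wedge\alpha_2 & \alpha_1,\alpha_2>W,\\ \neg(\alpha_1\vee\alpha_2)&\alpha_1,\alpha_2\le W,\\ (\neg\alpha_1)\vee\alpha_2&\alpha_1>W,\ \alpha_2\le W,\\ \alpha_1\vee(\neg\alpha_2)&\alpha_1\le W,\ \alpha_2>W.\end{cases}$$ The value of a clause is the maximum of the values of its literals ($\bot$ for $\Box$). An interpretation satisfies a clause set $S$ if every clause of $S$ has value $\ge W$ under every assignment; $S$ is *unsatisfiable* if no interpretation satisfies it. A *factor* of a clause $C$ is $C\sigma$ with $\sigma$ a most general unifier of a subset of $C$ (in particular, any renaming of $C$). If $C_1,C_2$ have no common variables, $A^a\in C_1$, $B^b\in C_2$, $a\wedge b<W$, $a\vee b\ge W$, and $\gamma$ is a most general unifier of $A$ and $B$, then $$\bigl((C_1\setminus\{A^a\})\gamma\cup(C_2\setminus\{B^b\})\gamma,\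 \ \alpha_1\wedge\alpha_2\wedge\neg(a\wedge b)\wedge(a\vee b)\bigr)$$ is a *binary resolvent* of $(C_1,\alpha_1)$ and $(C_2,\alpha_2)$. A *resolvent* of two clauses with reliabilities is a binary resolvent of factors of them, with the same reliabilities. A *resolution derivation* from $S$ is a finite or infinite sequence $S_0,S_1,\dots$ with $S_0=S$ and $S_{i+1}=S_i\cup\{(C,\alpha)\}$, where $(C,\alpha)\notin S_i$ is a resolvent of two members of $S_i$. It is *exhaustive* if for every resolvent $(C,\alpha)$ of two members of some $S_i$ there is an $S_j$ containing a clause that equals $C$ up to renaming of variables (with some reliability). **Theorem (soundness and completeness of linguistic resolution).** Let $S$ be a clause set. 1. $S$ is unsatisfiable if and only if there is a resolution derivation $S_0,S_1,\dots$ from $S$ such that some $S_i$ contains the empty clause $\Box$ (with some reliability). 2. For every exhaustive resolution derivation $S_0,S_1,\dots$ from $S$: $S$ is unsatisfiable if and only if some $S_i$ contains $\Box$. -/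

import Mathlib

universe u v w x y

/-! ### Linear symmetric hedge algebras -/

/-- The raw data of a symmetric hedge algebra: a set `H` of hedges acting as unary operations on
`X`, and two primary terms `cneg` (False) and `cpos` (True). -/
structure HedgeData (X : Type x) (H : Type y) where
  act : H → X → X
  cneg : X
  cpos : X

namespace HedgeData

variable {X : Type x} {H : Type y}

/-- `B.app [hₙ, …, h₁] u = hₙ … h₁ u`. -/
def app (B : HedgeData X H) (d : List H) (u : X) : X := d.foldr B.act u

/-- `H(u)`: the set of all terms `hₙ … h₁ u`, `n ≥ 0`. -/
def gen (B : HedgeData X H) (u : X) : Set X := {z | ∃ d : List H, z = B.app d u}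

def Independent (B : HedgeData X H) (a b : X) : Prop := a ∉ B.gen b ∧ b ∉ B.gen a

/-- `hₙ … h₁ u` is a canonical representation: no hedge in it acts trivially. -/
def Canonical (B : HedgeData X H) : List H → X → Prop
  | [], _ => True
  | h :: d, u => B.act h (B.app d u) ≠ B.app d u ∧ B.Canonical d u

/-- `b` is a contradictory element of `a`: exchange the primary term in a canonical
representation of `a`. -/
def Contradictory (B : HedgeData X H) (a b : X) : Prop :=
  ∃ d : List H,
    (B.Canonical d B.cpos ∧ a = B.app d B.cpos ∧ b = B.app d B.cneg) ∨
    (B.Canonical d B.cneg ∧ a = B.app d B.cneg ∧ b = B.app d B.cpos)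

variable [PartialOrder X]

/-- `k` is positive with respect to `h`. -/
def PositiveWrt (B : HedgeData X H) (k h : H) : Prop :=
  ∀ a, (a ≤ B.act h a → B.act h a ≤ B.act k (B.act h a)) ∧
    (B.act h a ≤ a → B.act k (B.act h a) ≤ B.act h a)

/-- `k` is negative with respect to `h`. -/
def NegativeWrt (B : HedgeData X H) (k h : H) : Prop :=
  ∀ a, (a ≤ B.act h a → B.act k (B.act h a) ≤ B.act h a) ∧
    (B.act h a ≤ a → B.act h a ≤ B.act k (B.act h a))

/-- `H⁺`. -/
def posHedges (B : HedgeData X H) : Set H := {h | B.cpos < B.act h B.cpos}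

/-- `H⁻`. -/
def negHedges (B : HedgeData X H) : Set H := {h | B.act h B.cpos < B.cpos}

def Converse (B : HedgeData X H) (h k : H) : Prop := ∀ a, B.act h a ≤ a ↔ a ≤ B.act k a

/-- `h ≥ k`: the hedge `h` modifies every term at least as strongly as `k`, in the same
direction. -/
def StrongerEq (B : HedgeData X H) (h k : H) : Prop :=
  ∀ a, (B.act k a ≤ B.act h a ∧ a ≤ B.act k a) ∨ (B.act h a ≤ B.act k a ∧ B.act k a ≤ a)

end HedgeData

/-- Linear symmetric hedge algebras (lin-HA) on a partially ordered set of terms `X`: the usual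
hedge algebra axioms, two primary terms `False < True`, and linearly ordered sets `H⁺`, `H⁻` of
hedges. The algebra is not required to be free. -/
structure LinHA (X : Type x) (H : Type y) [PartialOrder X] extends HedgeData X H where
  cneg_lt_cpos : cneg < cpos
  /-- every term is obtained from a primary term by a string of hedges -/
  generated : ∀ a, a ∈ toHedgeData.gen cneg ∨ a ∈ toHedgeData.gen cpos
  primary_independent : toHedgeData.Independent cneg cpos
  /-- each hedge strengthens or weakens each term -/
  ordering : ∀ h a, a ≤ act h a ∨ act h a ≤ a
  /-- each hedge is positive or negative with respect to each hedge -/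
  sign : ∀ k h, toHedgeData.PositiveWrt k h ∨ toHedgeData.NegativeWrt k h
  independent_gen : ∀ a b, toHedgeData.Independent a b → ∀ c ∈ toHedgeData.gen a,
    c ∉ toHedgeData.gen b
  not_mem_gen_act : ∀ h a, a ≠ act h a → a ∉ toHedgeData.gen (act h a)
  /-- terms inherit the meaning of the terms they modify -/
  inherit : ∀ h k a, h ≠ k → act h a ≤ act k a →
    ∀ h' k', act h' (act h a) ≤ act k' (act k a)
  independent_act : ∀ h k a, act h a ≠ act k a → toHedgeData.Independent (act h a) (act k a)
  le_act_of_le : ∀ h a b, a ∉ toHedgeData.gen b → a ≤ b → a ≤ act h b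
  act_le_of_le : ∀ h a b, a ∉ toHedgeData.gen b → b ≤ a → act h b ≤ a
  /-- `H` is divided into `H⁺` (strengthening both True and False) and `H⁻` (weakening both) -/
  divided : ∀ h, (cpos < act h cpos ∧ act h cneg < cneg) ∨ (act h cpos < cpos ∧ cneg < act h cneg)
  converse : ∀ h ∈ toHedgeData.posHedges, ∀ k ∈ toHedgeData.negHedges, toHedgeData.Converse h k
  linear_pos : ∀ h ∈ toHedgeData.posHedges, ∀ k ∈ toHedgeData.posHedges,
    toHedgeData.StrongerEq h k ∨ toHedgeData.StrongerEq k h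
  linear_neg : ∀ h ∈ toHedgeData.negHedges, ∀ k ∈ toHedgeData.negHedges,
    toHedgeData.StrongerEq h k ∨ toHedgeData.StrongerEq k h
  strongerEq_antisymm : ∀ h k, toHedgeData.StrongerEq h k → toHedgeData.StrongerEq k h → h = k
  /-- symmetry: every term has exactly one contradictory element -/
  symmetric : ∀ a, ∃! b, toHedgeData.Contradictory a b

namespace LinHA

variable {X : Type x} {H : Type y} [PartialOrder X]

theorem act_mem_gen {B : HedgeData X H} {a b : X} (h : H) (hab : a ∈ B.gen b) :
    B.act h a ∈ B.gen b := by
  obtain ⟨d, rfl⟩ := hab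
  exact ⟨h :: d, rfl⟩

theorem gen_trans {B : HedgeData X H} {a b c : X} (hab : a ∈ B.gen b) (hbc : b ∈ B.gen c) :
    a ∈ B.gen c := by
  obtain ⟨d, rfl⟩ := hab
  induction d with
  | nil => exact hbc
  | cons h d ih => exact act_mem_gen h ih

theorem self_mem_gen (B : HedgeData X H) (a : X) : a ∈ B.gen a := ⟨[], rfl⟩

theorem le_gen (A : LinHA X H) {a b c : X} (hab : a ∉ A.gen b) (hle : a ≤ b) (hc : c ∈ A.gen b) :
    a ≤ c := by
  obtain ⟨d, rfl⟩ := hc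
  induction d with
  | nil => exact hle
  | cons h d ih =>
    exact A.le_act_of_le h a _ (fun hm => hab (gen_trans hm ⟨d, rfl⟩)) ih

theorem gen_le (A : LinHA X H) {a b c : X} (hab : a ∉ A.gen b) (hle : b ≤ a) (hc : c ∈ A.gen b) :
    c ≤ a := by
  obtain ⟨d, rfl⟩ := hc
  induction d with
  | nil => exact hle
  | cons h d ih =>
    exact A.act_le_of_le h a _ (fun hm => hab (gen_trans hm ⟨d, rfl⟩)) ih

/-- Descendants of independent comparable terms are strictly ordered in the same way. -/
theorem gen_lt_gen (A : LinHA X H) {a b : X} (hi : A.Independent a b) (hle : a ≤ b) {c d : X}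
    (hc : c ∈ A.gen a) (hd : d ∈ A.gen b) : c < d := by
  have h1 : a ≤ d := A.le_gen hi.1 hle hd
  have h2 : d ∉ A.gen a := A.independent_gen b a ⟨hi.2, hi.1⟩ d hd
  refine lt_of_le_of_ne (A.gen_le h2 h1 hc) ?_
  rintro rfl
  exact h2 hc

theorem act_total (A : LinHA X H) (h k : H) (a : X) :
    A.act h a ≤ A.act k a ∨ A.act k a ≤ A.act h a := by
  have key : ∀ h ∈ A.posHedges, ∀ k ∈ A.negHedges,
      A.act h a ≤ A.act k a ∨ A.act k a ≤ A.act h a := by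
    intro h hh k hk
    have hc := A.converse h hh k hk a
    rcases A.ordering h a with h1 | h1
    · rcases A.ordering k a with h2 | h2
      · exact Or.inl ((hc.2 h2).trans h2)
      · exact Or.inr (h2.trans h1)
    · exact Or.inl (h1.trans (hc.1 h1))
  have same : A.StrongerEq h k ∨ A.StrongerEq k h →
      A.act h a ≤ A.act k a ∨ A.act k a ≤ A.act h a := by
    rintro (hs | hs)
    · rcases hs a with h1 | h1
      exacts [Or.inr h1.1, Or.inl h1.1]
    · rcases hs a with h1 | h1
      exacts [Or.inl h1.1, Or.inr h1.1]
  rcases A.divided h with hh | hh <;> rcases A.divided k with hk | hk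
  · exact same (A.linear_pos h hh.1 k hk.1)
  · exact key h hh.1 k hk.1
  · exact (key k hk.1 h hh.1).symm
  · exact same (A.linear_neg h hh.1 k hk.1)

theorem app_concat (B : HedgeData X H) (d : List H) (h : H) (a : X) :
    B.app (d ++ [h]) a = B.app d (B.act h a) := by
  simp [HedgeData.app, List.foldr_append]

theorem gen_total_self (A : LinHA X H) (a : X) (d : List H) :
    a ≤ A.app d a ∨ A.app d a ≤ a := by
  induction d using List.reverseRecOn generalizing a with
  | nil => exact Or.inl le_rfl
  | append_singleton d h ih =>
    rw [app_concat]
    by_cases he : a = A.act h a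
    · rw [← he]; exact ih a
    · have hn := A.not_mem_gen_act h a he
      rcases A.ordering h a with h1 | h1
      · exact Or.inl (A.le_gen hn h1 ⟨d, rfl⟩)
      · exact Or.inr (A.gen_le hn h1 ⟨d, rfl⟩)

theorem gen_total (A : LinHA X H) (a : X) (d e : List H) :
    A.app d a ≤ A.app e a ∨ A.app e a ≤ A.app d a := by
  induction d using List.reverseRecOn generalizing a e with
  | nil => exact A.gen_total_self a e
  | append_singleton d h ih =>
    induction e using List.reverseRecOn with
    | nil => exact (A.gen_total_self a _).symm
    | append_singleton e k _ =>
      rw [app_concat, app_concat]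
      by_cases he : A.act h a = A.act k a
      · rw [← he]; exact ih _ e
      · have hi := A.independent_act h k a he
        rcases A.act_total h k a with h1 | h1
        · exact Or.inl (A.gen_lt_gen hi h1 ⟨d, rfl⟩ ⟨e, rfl⟩).le
        · exact Or.inr (A.gen_lt_gen ⟨hi.2, hi.1⟩ h1 ⟨e, rfl⟩ ⟨d, rfl⟩).le

theorem neg_lt_pos (A : LinHA X H) {a b : X} (ha : a ∈ A.gen A.cneg) (hb : b ∈ A.gen A.cpos) :
    a < b :=
  A.gen_lt_gen A.primary_independent A.cneg_lt_cpos.le ha hb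

theorem total (A : LinHA X H) (a b : X) : a ≤ b ∨ b ≤ a := by
  rcases A.generated a with ha | ha <;> rcases A.generated b with hb | hb
  · obtain ⟨d, rfl⟩ := ha
    obtain ⟨e, rfl⟩ := hb
    exact A.gen_total _ d e
  · exact Or.inl (A.neg_lt_pos ha hb).le
  · exact Or.inr (A.neg_lt_pos hb ha).le
  · obtain ⟨d, rfl⟩ := ha
    obtain ⟨e, rfl⟩ := hb
    exact A.gen_total _ d e

/-- The contradictory element of a term. -/
noncomputable def contra (A : LinHA X H) (a : X) : X := (A.symmetric a).choose

/-- The linguistic truth domain `X ∪ {⊥, W, ⊤}`. -/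
inductive Value (A : LinHA X H) : Type x
  | bot : Value A
  | elem : X → Value A
  | mid : Value A
  | top : Value A

namespace Value

variable {A : LinHA X H}

/-- `⊥` is least, `⊤` is greatest, and `W` separates the terms generated from False from the
terms generated from True. -/
def le : Value A → Value A → Prop
  | bot, _ => True
  | _, top => True
  | elem a, elem b => a ≤ b
  | elem a, mid => a ∈ A.gen A.cneg
  | mid, elem b => b ∈ A.gen A.cpos
  | mid, mid => True
  | _, _ => False

open Classical in
noncomputable instance : LinearOrder (Value A) where
  le := le
  le_refl a := by cases a <;> simp [le]
  le_trans a b c := by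
    have down : ∀ s t : X, s ≤ t → t ∈ A.gen A.cneg → s ∈ A.gen A.cneg := fun s t hst ht =>
      (A.generated s).resolve_right fun hs => absurd hst (A.neg_lt_pos ht hs).not_ge
    have up : ∀ s t : X, s ≤ t → s ∈ A.gen A.cpos → t ∈ A.gen A.cpos := fun s t hst hs =>
      (A.generated t).resolve_left fun ht => absurd hst (A.neg_lt_pos ht hs).not_ge
    cases a <;> cases b <;> cases c <;> simp only [le] <;>
      first
        | tauto
        | exact fun h1 h2 => le_trans h1 h2
        | exact fun h1 h2 => down _ _ h1 h2
        | exact fun h1 h2 => up _ _ h2 h1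
        | exact fun h1 h2 => (A.neg_lt_pos h1 h2).le
  le_antisymm a b := by
    cases a <;> cases b <;> simp only [le] <;>
      first
        | tauto
        | exact fun h1 h2 => congrArg elem (le_antisymm h1 h2)
        | exact fun h1 h2 => absurd (A.neg_lt_pos h1 h2) (lt_irrefl _)
        | exact fun h1 h2 => absurd (A.neg_lt_pos h2 h1) (lt_irrefl _)
  le_total a b := by
    cases a <;> cases b <;> simp only [le] <;>
      first
        | tauto
        | exact A.total _ _
        | exact A.generated _
        | exact (A.generated _).symm
  toDecidableLE := Classical.decRel _

instance : BoundedOrder (Value A) where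
  bot := bot
  bot_le a := by cases a <;> trivial
  top := top
  le_top a := by cases a <;> trivial

/-- Negation on the truth domain. -/
noncomputable def neg : Value A → Value A
  | bot => top
  | elem a => elem (A.contra a)
  | mid => mid
  | top => bot

end Value

end LinHA

/-! ### Linguistic first-order logic: syntax

The symbols are those of a first-order language `L` (constants are the `0`-ary function symbols);
the variables are indexed by `ℕ`. -/

namespace LingLogic

open LinHA

structure Atom (L : FirstOrder.Language.{u, v}) where
  arity : ℕ
  pred : L.Relations arity
  args : Fin arity → L.Term ℕ

/-- Substitutions. -/
abbrev Sub (L : FirstOrder.Language.{u, v}) := ℕ → L.Term ℕ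

def Atom.subst {L : FirstOrder.Language.{u, v}} (P : Atom L) (s : Sub L) : Atom L :=
  ⟨P.arity, P.pred, fun i => (P.args i).subst s⟩

section

variable {X : Type x} {H : Type y} [PartialOrder X]

/-- The literal `P^a`: the atom `P` together with a truth value `a`. -/
@[ext]
structure Literal (L : FirstOrder.Language.{u, v}) (A : LinHA X H) where
  atom : Atom L
  exponent : Value A

variable {L : FirstOrder.Language.{u, v}} {A : LinHA X H}

def Literal.subst (l : Literal L A) (s : Sub L) : Literal L A := ⟨l.atom.subst s, l.exponent⟩

/-- A clause is a finite disjunction of literals, regarded as a finite set; the empty clause is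
`∅`. -/
abbrev Clause (L : FirstOrder.Language.{u, v}) (A : LinHA X H) := Finset (Literal L A)

open Classical in
noncomputable def Clause.subst (C : Clause L A) (s : Sub L) : Clause L A :=
  C.image fun l => l.subst s

/-- The variables occurring in a clause. -/
def Clause.vars (C : Clause L A) : Set ℕ :=
  {n | ∃ l ∈ C, ∃ i, n ∈ (l.atom.args i).varFinset}

/-- A clause together with its reliability. -/
abbrev RClause (L : FirstOrder.Language.{u, v}) (A : LinHA X H) := Clause L A × Value A

/-! ### Semantics -/

/-- An interpretation with domain `D`. Atoms take values in the truth domain other than the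
neutral value `W`. -/
structure Interpretation (L : FirstOrder.Language.{u, v}) (A : LinHA X H) (D : Type w) where
  func : ∀ {n : ℕ}, L.Functions n → (Fin n → D) → D
  pred : ∀ {n : ℕ}, L.Relations n → (Fin n → D) → Value A
  pred_ne_mid : ∀ {n : ℕ} (P : L.Relations n) (a : Fin n → D), pred P a ≠ Value.mid

namespace Interpretation

variable {D : Type w}

/-- Value of a term under an assignment `e` of the variables. -/
def term (I : Interpretation L A D) (e : ℕ → D) : L.Term ℕ → D
  | .var n => e n
  | .func f ts => I.func f fun i => I.term e (ts i)

def atom (I : Interpretation L A D) (e : ℕ → D) (P : Atom L) : Value A :=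
  I.pred P.pred fun i => I.term e (P.args i)

open Classical in
/-- Truth value of a literal `P^a₂` when the atom `P` has the value `a₁`. -/
noncomputable def literalValue (a₁ a₂ : Value A) : Value A :=
  if Value.mid < a₁ ∧ Value.mid < a₂ then a₁ ⊓ a₂
  else if a₁ ≤ Value.mid ∧ a₂ ≤ Value.mid then Value.neg (a₁ ⊔ a₂)
  else if Value.mid < a₁ then Value.neg a₁ ⊔ a₂
  else a₁ ⊔ Value.neg a₂

noncomputable def literal (I : Interpretation L A D) (e : ℕ → D) (l : Literal L A) : Value A :=
  literalValue (I.atom e l.atom) l.exponent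

/-- A disjunction has the largest of the values of its members; the empty clause has value `⊥`. -/
noncomputable def clause (I : Interpretation L A D) (e : ℕ → D) (C : Clause L A) : Value A :=
  C.sup (I.literal e)

/-- `I` satisfies a clause set, read as the conjunction of the universal closures of its clauses:
the minimum of the values of all clauses under all assignments is `≥ W` precisely if each of these
values is. -/
def Satisfies (I : Interpretation L A D) (S : Set (RClause L A)) : Prop :=
  ∀ c ∈ S, ∀ e : ℕ → D, Value.mid ≤ I.clause e c.1

end Interpretation

/-- No interpretation satisfies `S`. -/
def Unsatisfiable (S : Set (RClause L A)) : Prop :=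
  ∀ (D : Type (max u w)) [Nonempty D] (I : Interpretation L A D), ¬ I.Satisfies S

/-! ### Resolution -/

/-- `s` is a most general one among the substitutions with the property `U`. -/
def IsMostGeneral (U : Sub L → Prop) (s : Sub L) : Prop :=
  U s ∧ ∀ t, U t → ∃ r : Sub L, ∀ n, t n = (s n).subst r

/-- `F = Cσ` with `σ` a most general unifier of a subset `K` of `C`. If `K` has at most one
element, then `σ` is a renaming of the variables, so that variants are factors. -/
def IsFactor (F C : Clause L A) : Prop :=
  ∃ K ⊆ C, ∃ s : Sub L,
    IsMostGeneral (fun t => ∀ l ∈ K, ∀ l' ∈ K, l.subst t = l'.subst t) s ∧ F = C.subst s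

/-- The reliability of the conclusion of the linguistic resolution rule. -/
noncomputable def reliability (r₁ r₂ a b : Value A) : Value A :=
  r₁ ⊓ r₂ ⊓ Value.neg (a ⊓ b) ⊓ (a ⊔ b)

open Classical in
/-- The linguistic resolution rule: `c` is a binary resolvent of `c₁` and `c₂`. -/
def IsBinaryResolvent (c₁ c₂ c : RClause L A) : Prop :=
  Disjoint (Clause.vars c₁.1) (Clause.vars c₂.1) ∧
  ∃ l₁ ∈ c₁.1, ∃ l₂ ∈ c₂.1, ∃ s : Sub L,
    l₁.exponent ⊓ l₂.exponent < Value.mid ∧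
    Value.mid ≤ l₁.exponent ⊔ l₂.exponent ∧
    IsMostGeneral (fun t => l₁.atom.subst t = l₂.atom.subst t) s ∧
    c.1 = Clause.subst (c₁.1.erase l₁) s ∪ Clause.subst (c₂.1.erase l₂) s ∧
    c.2 = reliability c₁.2 c₂.2 l₁.exponent l₂.exponent

/-- A resolvent is a binary resolvent of factors. -/
def IsResolvent (c₁ c₂ c : RClause L A) : Prop :=
  ∃ F₁ F₂ : Clause L A, IsFactor F₁ c₁.1 ∧ IsFactor F₂ c₂.1 ∧
    IsBinaryResolvent (F₁, c₁.2) (F₂, c₂.2) c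

/-- A resolution derivation `T 0, T 1, …` from `S`; it is infinite if `len = ⊤`, and otherwise it
stops with `T len`. -/
structure IsDerivation (S : Set (RClause L A)) (len : ℕ∞) (T : ℕ → Set (RClause L A)) : Prop where
  zero : T 0 = S
  step : ∀ i : ℕ, (i : ℕ∞) < len → ∃ c, c ∉ T i ∧
    (∃ c₁ ∈ T i, ∃ c₂ ∈ T i, IsResolvent c₁ c₂ c) ∧ T (i + 1) = T i ∪ {c}

/-- `C'` is `C` up to the names of variables. -/
def IsVariant (C' C : Clause L A) : Prop :=
  ∃ p : Equiv.Perm ℕ, C' = C.subst fun n => FirstOrder.Language.Term.var (p n)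

/-- A derivation is exhaustive if no resolvent is neglected forever: every resolvent of two clauses
of a stage belongs to some stage, up to renaming of its variables and up to its reliability. -/
def IsExhaustive (len : ℕ∞) (T : ℕ → Set (RClause L A)) : Prop :=
  ∀ i : ℕ, (i : ℕ∞) ≤ len → ∀ c₁ ∈ T i, ∀ c₂ ∈ T i, ∀ c, IsResolvent c₁ c₂ c →
    ∃ j : ℕ, (j : ℕ∞) ≤ len ∧ ∃ c' ∈ T j, IsVariant c'.1 c.1

/-- Some stage of the derivation contains the empty clause. -/
def ReachesEmpty (len : ℕ∞) (T : ℕ → Set (RClause L A)) : Prop :=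
  ∃ i : ℕ, (i : ℕ∞) ≤ len ∧ ∃ r : Value A, ((∅ : Clause L A), r) ∈ T i

end

end LingLogic

/-! Neither exponents of literals nor values of atoms equal `W`, so `P^a` has value `≥ W` exactly
when the value of `P` and `a` lie on the same side of `W` (`mid_le_literalValue`). Satisfaction is
thus classical satisfaction, with `P^a` read as `P` if `a > W` and as the negation of `P` otherwise.
The side condition of the rule says that the two literals are complementary, and reliabilities are
only carried along.

Soundness is then the classical argument (`IsResolvent.valid`). For completeness, take a clause set
closed under resolution up to renaming and without the empty clause, and let `G` consist of all
clauses containing an instance of a member. Lifting (`exists_resolvent`, based on the existence of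
most general unifiers) makes `G` closed under cuts. A Zorn argument (`exists_valuation`) gives a
valuation of atoms satisfying `G`, and this valuation is a model over the domain of all terms,
variables included. The theorem follows by applying this to the set of all derivable clauses, and to
the union of the stages of an exhaustive derivation. -/

namespace LingLogic

open LinHA FirstOrder.Language

/-! ### Terms and substitutions -/

section Terms

variable {L : FirstOrder.Language.{u, v}}

/-- First apply `s`, then `r`. -/
def Sub.comp (s r : Sub L) : Sub L := fun n => (s n).subst r

/-- The substitution that renames the variables by `f`. -/
def Sub.rename (L : FirstOrder.Language.{u, v}) (f : ℕ → ℕ) : Sub L := fun n => .var (f n)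

theorem term_subst_subst (t : L.Term ℕ) (s r : Sub L) :
    (t.subst s).subst r = t.subst (s.comp r) := by
  induction t with
  | var n => rfl
  | func f ts ih => simp only [Term.subst]; congr 1; funext i; exact ih i

theorem term_subst_var (t : L.Term ℕ) : t.subst (.var : Sub L) = t := by
  induction t with
  | var n => rfl
  | func f ts ih => simp only [Term.subst]; congr 1; funext i; exact ih i

theorem term_subst_congr {t : L.Term ℕ} {s r : Sub L} (h : ∀ n ∈ t.varFinset, s n = r n) :
    t.subst s = t.subst r := by
  induction t with
  | var n => exact h n (by simp [Term.varFinset])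
  | func f ts ih =>
    simp only [Term.subst]
    congr 1
    funext i
    exact ih i fun n hn => h n (by
      simp only [Term.varFinset, Finset.mem_biUnion]
      exact ⟨i, by simp, hn⟩)

theorem varFinset_subst_rename {t : L.Term ℕ} {f : ℕ → ℕ} {n : ℕ}
    (h : n ∈ (t.subst (Sub.rename L f)).varFinset) : n ∈ Set.range f := by
  induction t with
  | var m =>
    simp only [Term.subst, Sub.rename, Term.varFinset, Finset.mem_singleton] at h
    exact ⟨m, h.symm⟩
  | func g ts ih =>
    simp only [Term.subst, Term.varFinset, Finset.mem_biUnion] at h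
    obtain ⟨i, -, hi⟩ := h
    exact ih i hi

/-- The number of symbols of a term. -/
def termSize : L.Term ℕ → ℕ
  | .var _ => 1
  | .func _ ts => 1 + ∑ i, termSize (ts i)

theorem termSize_pos (t : L.Term ℕ) : 0 < termSize t := by
  cases t <;> simp only [termSize] <;> omega

theorem termSize_le_subst {t : L.Term ℕ} {n : ℕ} (s : Sub L) (h : n ∈ t.varFinset) :
    termSize (s n) ≤ termSize (t.subst s) := by
  induction t with
  | var m =>
    simp only [Term.varFinset, Finset.mem_singleton] at h
    subst h
    rfl
  | func f ts ih =>
    simp only [Term.varFinset, Finset.mem_biUnion] at h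
    obtain ⟨i, -, hi⟩ := h
    have h1 := Finset.single_le_sum (f := fun i => termSize ((ts i).subst s))
      (fun _ _ => Nat.zero_le _) (Finset.mem_univ i)
    have h2 := ih i hi
    simp only [Term.subst, termSize] at h1 ⊢
    omega

/-- The occurs check: if the variable occurred properly inside `t`, then `t.subst s` would be
strictly larger than `s n`. -/
theorem not_mem_varFinset_of_subst_eq {t : L.Term ℕ} {n : ℕ} {s : Sub L} (h : s n = t.subst s)
    (ht : t ≠ .var n) : n ∉ t.varFinset := by
  intro hn
  cases t with
  | var m =>
    simp only [Term.varFinset, Finset.mem_singleton] at hn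
    exact ht (by rw [hn])
  | func f ts =>
    simp only [Term.varFinset, Finset.mem_biUnion] at hn
    obtain ⟨i, -, hi⟩ := hn
    have h1 := Finset.single_le_sum (f := fun i => termSize ((ts i).subst s))
      (fun _ _ => Nat.zero_le _) (Finset.mem_univ i)
    have h2 := termSize_le_subst s hi
    rw [h] at h2
    simp only [Term.subst, termSize] at h1 h2
    omega

/-! ### Unification -/

theorem IsMostGeneral.congr {U V : Sub L → Prop} {s : Sub L} (h : ∀ t, U t ↔ V t)
    (hs : IsMostGeneral U s) : IsMostGeneral V s :=
  ⟨(h s).1 hs.1, fun t ht => hs.2 t ((h t).2 ht)⟩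

/-- An injective renaming is undone by a left inverse of `f`. As `f` need not be surjective, the
variables can be moved into a prescribed infinite set, which separates two factors. -/
theorem IsMostGeneral.rename {U : Sub L → Prop} {s : Sub L} (hs : IsMostGeneral U s)
    (hU : ∀ t r, U t → U (t.comp r)) {f : ℕ → ℕ} (hf : f.Injective) :
    IsMostGeneral U (s.comp (Sub.rename L f)) := by
  refine ⟨hU _ _ hs.1, fun t ht => ?_⟩
  obtain ⟨r, hr⟩ := hs.2 t ht
  refine ⟨fun n => r (Function.invFun f n), fun n => ?_⟩
  rw [hr, Sub.comp, term_subst_subst]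
  congr 1
  funext m
  simp only [Sub.comp, Sub.rename, Term.subst]
  rw [Function.leftInverse_invFun hf m]

/-- `t` solves the system `E` of equations. -/
def Solves (t : Sub L) (E : List (L.Term ℕ × L.Term ℕ)) : Prop :=
  ∀ p ∈ E, p.1.subst t = p.2.subst t

/-- The size of the left-hand sides of a system of equations after a substitution. -/
def systemSize (t : Sub L) (E : List (L.Term ℕ × L.Term ℕ)) : ℕ :=
  (E.map fun p => termSize (p.1.subst t)).sum

/-- A solution of `n = b` absorbs the elimination of `n`; hence elimination changes neither these
solutions nor the size of a system under them. -/
theorem subst_update_of_eq {n : ℕ} {b : L.Term ℕ} {t : Sub L} (h : t n = b.subst t) (a : L.Term ℕ) :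
    (a.subst (Function.update .var n b : Sub L)).subst t = a.subst t := by
  rw [term_subst_subst]
  congr 1
  funext m
  by_cases hm : m = n
  · subst hm; simp [Sub.comp, h]
  · simp [Sub.comp, hm, Term.subst]

/-- Replacing `n` by `b` in `E` leaves `systemSize t₀` unchanged, because `t₀` solves `n = b`. So
the induction hypothesis reaches the reduced system without counting variables. -/
theorem exists_mgu_eliminate {n : ℕ} {b : L.Term ℕ} {E : List (L.Term ℕ × L.Term ℕ)} {t₀ : Sub L}
    (h₀ : Solves t₀ ((.var n, b) :: E))
    (ih : ∀ (E' : List (L.Term ℕ × L.Term ℕ)), systemSize t₀ E' ≤ systemSize t₀ E → Solves t₀ E' →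
      ∃ s, IsMostGeneral (fun t => Solves t E') s) :
    ∃ s, IsMostGeneral (fun t => Solves t ((.var n, b) :: E)) s := by
  simp only [Solves, List.forall_mem_cons] at h₀
  by_cases hb : b = .var n
  · obtain ⟨s, hs⟩ := ih E le_rfl h₀.2
    exact ⟨s, hs.congr fun t => by simp [Solves, hb]⟩
  have hn := not_mem_varFinset_of_subst_eq (s := t₀) h₀.1 hb
  set s₀ : Sub L := Function.update .var n b with hs₀
  have hbs : b.subst s₀ = b := by
    conv_rhs => rw [← term_subst_var b]
    refine term_subst_congr fun m hm => ?_
    rw [hs₀, Function.update_of_ne]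
    rintro rfl
    exact hn hm
  have solves : ∀ t : Sub L, t n = b.subst t →
      (Solves t (E.map fun p => (p.1.subst s₀, p.2.subst s₀)) ↔ Solves t E) := by
    intro t ht
    simp only [Solves, List.forall_mem_map, hs₀, subst_update_of_eq ht]
  obtain ⟨s, hs, hmg⟩ := ih (E.map fun p => (p.1.subst s₀, p.2.subst s₀))
    (by
      simp only [systemSize, List.map_map, Function.comp_def]
      simp only [hs₀, subst_update_of_eq (show t₀ n = b.subst t₀ from h₀.1), le_refl])
    ((solves t₀ h₀.1).2 h₀.2)
  refine ⟨s₀.comp s, ?_, ?_⟩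
  · simp only [Solves, List.forall_mem_cons, List.forall_mem_map] at hs ⊢
    refine ⟨?_, fun p hp => ?_⟩
    · rw [← term_subst_subst b, hbs]
      simp [Term.subst, Sub.comp, hs₀]
    · rw [← term_subst_subst, ← term_subst_subst]
      exact hs p hp
  · intro t ht
    simp only [Solves, List.forall_mem_cons] at ht
    obtain ⟨r, hr⟩ := hmg t ((solves t ht.1).2 ht.2)
    refine ⟨r, fun m => ?_⟩
    have h1 := subst_update_of_eq (show t n = b.subst t from ht.1) (.var m)
    have h2 : t = s.comp r := funext hr
    rw [Sub.comp, term_subst_subst, ← h2]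
    exact h1.symm

/-- A solvable system of equations has a most general solution. -/
theorem exists_mgu_system (N : ℕ) : ∀ (E : List (L.Term ℕ × L.Term ℕ)) (t₀ : Sub L),
    systemSize t₀ E ≤ N → Solves t₀ E → ∃ s, IsMostGeneral (fun t => Solves t E) s := by
  -- The measure is taken under the fixed solution `t₀`: discarding an equation and decomposing `f
  -- ts = f us` both decrease it.
  induction N using Nat.strong_induction_on with
  | _ N ih =>
  intro E t₀ hN h₀
  have smaller : ∀ p E₁, E = p :: E₁ → systemSize t₀ E₁ < N := by
    rintro p E₁ rfl
    have := termSize_pos (p.1.subst t₀)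
    simp only [systemSize, List.map_cons, List.sum_cons] at hN ⊢
    omega
  match E with
  | [] => exact ⟨.var, by simp [Solves], fun t _ => ⟨t, fun n => rfl⟩⟩
  | (.var n, b) :: E =>
    exact exists_mgu_eliminate h₀ fun E' hE' =>
      ih _ (smaller _ _ rfl) E' t₀ hE'
  | (.func f ts, .var n) :: E =>
    -- Swapping the sides may change the measure, but only the size of the tail matters for
    -- elimination.
    have swap : ∀ t : Sub L, Solves t ((.var n, .func f ts) :: E) ↔
        Solves t ((.func f ts, .var n) :: E) := fun t => by
      simp only [Solves, List.forall_mem_cons]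
      exact and_congr_left fun _ => eq_comm
    obtain ⟨s, hs⟩ := exists_mgu_eliminate ((swap t₀).2 h₀) fun E' hE' =>
      ih _ (smaller _ _ rfl) E' t₀ hE'
    exact ⟨s, hs.congr swap⟩
  | (.func (l := k) f ts, .func (l := m) g us) :: E =>
    have h1 : (Term.func f ts).subst t₀ = (Term.func g us).subst t₀ := h₀ _ List.mem_cons_self
    simp only [Term.subst] at h1
    -- The solution `t₀` excludes a clash of function symbols.
    obtain ⟨rfl, h2, -⟩ := Term.func.inj h1
    obtain rfl := eq_of_heq h2
    have equiv : ∀ t : Sub L, Solves t (List.ofFn (fun i => (ts i, us i)) ++ E) ↔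
        Solves t ((.func f ts, .func f us) :: E) := fun t => by
      simp only [Solves, List.forall_mem_cons, List.forall_mem_append, List.forall_mem_ofFn_iff,
        Term.subst, Term.func.injEq, heq_eq_eq, true_and, funext_iff]
    obtain ⟨s, hs⟩ := ih (systemSize t₀ (List.ofFn (fun i => (ts i, us i)) ++ E)) (by
        simp only [systemSize, List.map_append, List.sum_append, List.map_ofFn, List.map_cons,
          List.sum_cons, List.sum_ofFn, Function.comp_def, Term.subst, termSize] at hN ⊢
        omega) _ t₀ le_rfl ((equiv t₀).2 h₀)
    exact ⟨s, hs.congr equiv⟩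

/-! ### Atoms -/

theorem atom_subst_subst (P : Atom L) (s r : Sub L) :
    (P.subst s).subst r = P.subst (s.comp r) := by
  simp only [Atom.subst, term_subst_subst]

theorem exists_system_of_atoms {P Q : Atom L} {t₀ : Sub L} (h : P.subst t₀ = Q.subst t₀) :
    ∃ E, ∀ t, Solves t E ↔ P.subst t = Q.subst t := by
  obtain ⟨n, p, a⟩ := P
  obtain ⟨m, q, b⟩ := Q
  simp only [Atom.subst] at h
  obtain ⟨rfl, h1, -⟩ := Atom.mk.inj h
  obtain rfl := eq_of_heq h1
  refine ⟨List.ofFn fun i => (a i, b i), fun t => ?_⟩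
  simp only [Solves, List.forall_mem_ofFn_iff, Atom.subst, Atom.mk.injEq, heq_eq_eq, true_and,
    funext_iff]

theorem exists_mgu_atoms (K : List (Atom L × Atom L)) {t₀ : Sub L}
    (h : ∀ p ∈ K, p.1.subst t₀ = p.2.subst t₀) :
    ∃ s, IsMostGeneral (fun t : Sub L => ∀ p ∈ K, p.1.subst t = p.2.subst t) s := by
  have system : ∃ E, ∀ t, Solves t E ↔ ∀ p ∈ K, p.1.subst t = p.2.subst t := by
    induction K with
    | nil => exact ⟨[], fun t => by simp [Solves]⟩
    | cons p K ih =>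
      rw [List.forall_mem_cons] at h
      obtain ⟨E, hE⟩ := ih h.2
      obtain ⟨E', hE'⟩ := exists_system_of_atoms h.1
      refine ⟨E' ++ E, fun t => ?_⟩
      rw [List.forall_mem_cons, ← hE, ← hE']
      simp only [Solves, List.forall_mem_append]
  obtain ⟨E, hE⟩ := system
  obtain ⟨s, hs⟩ := exists_mgu_system _ E t₀ le_rfl ((hE t₀).2 h)
  exact ⟨s, hs.congr hE⟩

end Terms

variable {X : Type x} {H : Type y} [PartialOrder X] {A : LinHA X H}

/-! ### The truth domain -/

theorem mid_lt_elem {a : X} : Value.mid < (Value.elem a : Value A) ↔ a ∈ A.gen A.cpos :=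
  ⟨fun h => h.le, fun h => lt_of_le_of_ne h (by simp)⟩

theorem elem_lt_mid {a : X} : (Value.elem a : Value A) < Value.mid ↔ a ∈ A.gen A.cneg :=
  ⟨fun h => h.le, fun h => lt_of_le_of_ne h (by simp)⟩

theorem bot_lt_mid : (⊥ : Value A) < Value.mid :=
  lt_of_le_of_ne bot_le (by simp [Bot.bot])

theorem mid_lt_top : (Value.mid : Value A) < ⊤ :=
  lt_of_le_of_ne le_top (by simp [Top.top])

/-- The contradictory element exchanges the primary term, and no term is generated from both primary
terms. -/
theorem contra_mem_gen (a : X) :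
    (a ∈ A.gen A.cpos → A.contra a ∈ A.gen A.cneg) ∧
      (a ∈ A.gen A.cneg → A.contra a ∈ A.gen A.cpos) := by
  obtain ⟨d, ⟨-, h1, h2⟩ | ⟨-, h1, h2⟩⟩ := (A.symmetric a).choose_spec.1
  · exact ⟨fun _ => ⟨d, h2⟩, fun h => absurd (A.neg_lt_pos h ⟨d, h1⟩) (lt_irrefl _)⟩
  · exact ⟨fun h => absurd (A.neg_lt_pos ⟨d, h1⟩ h) (lt_irrefl _), fun _ => ⟨d, h2⟩⟩

theorem neg_lt_mid {a : Value A} (h : Value.mid < a) : Value.neg a < Value.mid := by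
  cases a with
  | bot => exact absurd (h.trans bot_lt_mid) (lt_irrefl _)
  | elem a => exact elem_lt_mid.2 ((contra_mem_gen a).1 (mid_lt_elem.1 h))
  | mid => exact absurd h (lt_irrefl _)
  | top => exact bot_lt_mid

theorem mid_lt_neg {a : Value A} (h : a < Value.mid) : Value.mid < Value.neg a := by
  cases a with
  | bot => exact mid_lt_top
  | elem a => exact mid_lt_elem.2 ((contra_mem_gen a).2 (elem_lt_mid.1 h))
  | mid => exact absurd h (lt_irrefl _)
  | top => exact absurd (mid_lt_top.trans h) (lt_irrefl _)

/-- A literal `P^a` is true precisely if the value of `P` and `a` lie on the same side of `W`. -/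
theorem mid_le_literalValue {a b : Value A} (ha : a ≠ Value.mid) (hb : b ≠ Value.mid) :
    Value.mid ≤ Interpretation.literalValue a b ↔ (Value.mid < a ↔ Value.mid < b) := by
  unfold Interpretation.literalValue
  rcases ha.lt_or_gt with ha | ha <;> rcases hb.lt_or_gt with hb | hb
  · simp only [ha.not_gt, hb.not_gt, ha.le, hb.le, and_self, if_false, if_true, iff_self, iff_true]
    exact (mid_lt_neg (max_lt ha hb)).le
  · simp only [ha.not_gt, hb, hb.not_ge, and_true, and_false, if_false, false_iff, not_true,
      iff_false, not_le]
    exact max_lt ha (neg_lt_mid hb)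
  · simp only [ha, hb.not_gt, ha.not_ge, and_false, false_and, if_false, if_true, iff_false,
      not_true, not_le]
    exact max_lt (neg_lt_mid ha) hb
  · simp only [ha, hb, and_self, if_true, iff_self, iff_true]
    exact le_inf ha.le hb.le

variable {L : FirstOrder.Language.{u, v}}

theorem literal_subst_subst (l : Literal L A) (s r : Sub L) :
    (l.subst s).subst r = l.subst (s.comp r) := by
  simp only [Literal.subst, atom_subst_subst]

theorem clause_mem_subst {C : Clause L A} {s : Sub L} {l : Literal L A} :
    l ∈ C.subst s ↔ ∃ k ∈ C, k.subst s = l := by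
  simp [Clause.subst]

theorem clause_subst_subst (C : Clause L A) (s r : Sub L) :
    (C.subst s).subst r = C.subst (s.comp r) := by
  ext l
  simp only [clause_mem_subst, exists_exists_and_eq_and, literal_subst_subst]

theorem literal_subst_congr {C : Clause L A} {l : Literal L A} (hl : l ∈ C) {s r : Sub L}
    (h : ∀ n ∈ C.vars, s n = r n) : l.subst s = l.subst r := by
  simp only [Literal.subst, Atom.subst]
  congr 2
  funext i
  exact term_subst_congr fun n hn => h n ⟨l, hl, i, hn⟩

/-! ### Soundness -/

section Soundness

variable {D : Type w} (I : Interpretation L A D)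

theorem interpretation_term_subst (e : ℕ → D) (t : L.Term ℕ) (s : Sub L) :
    I.term e (t.subst s) = I.term (fun n => I.term e (s n)) t := by
  induction t with
  | var n => rfl
  | func f ts ih => simp only [Term.subst, Interpretation.term, ih]

theorem interpretation_literal_subst (e : ℕ → D) (l : Literal L A) (s : Sub L) :
    I.literal e (l.subst s) = I.literal (fun n => I.term e (s n)) l := by
  simp only [Interpretation.literal, Interpretation.atom, Literal.subst, Atom.subst,
    interpretation_term_subst]

theorem mid_le_clause {e : ℕ → D} {C : Clause L A} :
    Value.mid ≤ I.clause e C ↔ ∃ l ∈ C, Value.mid ≤ I.literal e l :=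
  Finset.le_sup_iff bot_lt_mid

theorem mid_le_literal {e : ℕ → D} {l : Literal L A} (hl : l.exponent ≠ Value.mid) :
    Value.mid ≤ I.literal e l ↔ (Value.mid < I.atom e l.atom ↔ Value.mid < l.exponent) :=
  mid_le_literalValue (I.pred_ne_mid _ _) hl

/-- `C` is true in `I` under all assignments. -/
def Valid (C : Clause L A) : Prop := ∀ e, Value.mid ≤ I.clause e C

/-- No exponent of `C` is `W`. -/
def Proper (C : Clause L A) : Prop := ∀ l ∈ C, l.exponent ≠ Value.mid

variable {I}

theorem Valid.subst {C : Clause L A} (h : Valid I C) (s : Sub L) : Valid I (C.subst s) := by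
  intro e
  obtain ⟨l, hl, hv⟩ := (mid_le_clause I).1 (h fun n => I.term e (s n))
  exact (mid_le_clause I).2 ⟨l.subst s, clause_mem_subst.2 ⟨l, hl, rfl⟩,
    by rwa [interpretation_literal_subst]⟩

theorem Proper.subst {C : Clause L A} (h : Proper C) (s : Sub L) : Proper (C.subst s) := by
  intro l hl
  obtain ⟨k, hk, rfl⟩ := clause_mem_subst.1 hl
  exact h k hk

/-- Two exponents lie on different sides of `W`. -/
def Opposite (a b : Value A) : Prop := a ⊓ b < Value.mid ∧ Value.mid ≤ a ⊔ b

theorem opposite_iff {a b : Value A} (ha : a ≠ Value.mid) (hb : b ≠ Value.mid) :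
    Opposite a b ↔ ¬(Value.mid < a ↔ Value.mid < b) := by
  rcases ha.lt_or_gt with ha | ha <;> rcases hb.lt_or_gt with hb | hb <;>
    simp [Opposite, ha, hb, ha.le, hb.le, ha.not_ge, hb.not_ge, ha.not_gt, hb.not_gt]

open Classical in
theorem IsResolvent.proper {c₁ c₂ c : RClause L A} (h : IsResolvent c₁ c₂ c) (h₁ : Proper c₁.1)
    (h₂ : Proper c₂.1) : Proper c.1 := by
  obtain ⟨F₁, F₂, ⟨-, -, s₁, -, rfl⟩, ⟨-, -, s₂, -, rfl⟩, -, l₁, -, l₂, -, s, -, -, -, hc, -⟩ := h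
  rw [hc]
  intro l hl
  rcases Finset.mem_union.1 hl with hl | hl <;> obtain ⟨k, hk, rfl⟩ := clause_mem_subst.1 hl
  · exact (h₁.subst s₁) k (Finset.mem_of_mem_erase hk)
  · exact (h₂.subst s₂) k (Finset.mem_of_mem_erase hk)

open Classical in
-- Evaluate both factors at the assignment `n ↦ I.term e (s n)`. Each has a true literal; these
-- cannot both be the literals resolved upon, which have a common atom after `s` and opposite signs,
-- so one survives in the resolvent.
theorem IsResolvent.valid {c₁ c₂ c : RClause L A} (h : IsResolvent c₁ c₂ c) (h₁ : Proper c₁.1)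
    (h₂ : Proper c₂.1) (v₁ : Valid I c₁.1) (v₂ : Valid I c₂.1) : Valid I c.1 := by
  obtain ⟨F₁, F₂, ⟨-, -, s₁, -, rfl⟩, ⟨-, -, s₂, -, rfl⟩, -, l₁, hl₁, l₂, hl₂, s, ho, ho',
    hs, hc, -⟩ := h
  intro e
  obtain ⟨k₁, hk₁, hv₁⟩ := (mid_le_clause I).1 ((v₁.subst s₁) fun n => I.term e (s n))
  obtain ⟨k₂, hk₂, hv₂⟩ := (mid_le_clause I).1 ((v₂.subst s₂) fun n => I.term e (s n))
  rw [mid_le_clause, hc]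
  by_cases h1 : k₁ = l₁
  · by_cases h2 : k₂ = l₂
    · subst h1 h2
      exfalso
      have p₁ := (h₁.subst s₁) k₁ hl₁
      have p₂ := (h₂.subst s₂) k₂ hl₂
      refine (opposite_iff p₁ p₂).1 ⟨ho, ho'⟩ ?_
      rw [← (mid_le_literal I p₁).1 hv₁, ← (mid_le_literal I p₂).1 hv₂]
      have ha : ∀ P : Atom L, I.atom (fun n => I.term e (s n)) P = I.atom e (P.subst s) :=
        fun P => by simp only [Interpretation.atom, Atom.subst, interpretation_term_subst]
      rw [ha, ha, hs.1]
    · exact ⟨k₂.subst s, Finset.mem_union_right _ (clause_mem_subst.2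
        ⟨k₂, Finset.mem_erase.2 ⟨h2, hk₂⟩, rfl⟩), by rwa [interpretation_literal_subst]⟩
  · exact ⟨k₁.subst s, Finset.mem_union_left _ (clause_mem_subst.2
      ⟨k₁, Finset.mem_erase.2 ⟨h1, hk₁⟩, rfl⟩), by rwa [interpretation_literal_subst]⟩

end Soundness

/-! ### Resolution derivations -/

section Derivations

variable {S : Set (RClause L A)} {len : ℕ∞} {T : ℕ → Set (RClause L A)}

theorem IsDerivation.mono (h : IsDerivation S len T) {i j : ℕ} (hij : i ≤ j)
    (hj : (j : ℕ∞) ≤ len) : T i ⊆ T j := by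
  induction j, hij using Nat.le_induction with
  | base => exact subset_rfl
  | succ j hij ih =>
    have hlt : (j : ℕ∞) < len := lt_of_lt_of_le (by exact_mod_cast Nat.lt_succ_self j) hj
    obtain ⟨c, -, -, hc⟩ := h.step j hlt
    exact (ih hlt.le).trans (hc ▸ Set.subset_union_left)

theorem IsDerivation.induction (h : IsDerivation S len T) {p : RClause L A → Prop}
    (base : ∀ c ∈ S, p c) (step : ∀ c₁ c₂ c, p c₁ → p c₂ → IsResolvent c₁ c₂ c → p c) {i : ℕ}
    (hi : (i : ℕ∞) ≤ len) : ∀ c ∈ T i, p c := by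
  induction i with
  | zero => rw [h.zero]; exact base
  | succ i ih =>
    have hlt : (i : ℕ∞) < len := lt_of_lt_of_le (by exact_mod_cast Nat.lt_succ_self i) hi
    obtain ⟨c, -, ⟨c₁, h₁, c₂, h₂, hr⟩, hc⟩ := h.step i hlt
    rw [hc]
    rintro c' (hc' | rfl)
    · exact ih hlt.le c' hc'
    · exact step _ _ _ (ih hlt.le _ h₁) (ih hlt.le _ h₂) hr

theorem IsDerivation.unsatisfiable (h : IsDerivation S len T)
    (hS : ∀ c ∈ S, Proper c.1) (hE : ReachesEmpty len T) : Unsatisfiable.{u, v, w} S := by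
  intro D _ I hI
  obtain ⟨i, hi, r, hr⟩ := hE
  have hv := (h.induction (p := fun c => Proper c.1 ∧ Valid I c.1)
    (fun c hc => ⟨hS c hc, fun e => hI c hc e⟩)
    (fun _ _ _ p₁ p₂ hc => ⟨hc.proper p₁.1 p₂.1, hc.valid p₁.1 p₂.1 p₁.2 p₂.2⟩) hi _ hr).2
  obtain ⟨l, hl, -⟩ := (mid_le_clause I).1 (hv fun _ => Classical.arbitrary D)
  simp at hl

/-- One step of a resolution derivation. -/
def Extends (T T' : Set (RClause L A)) : Prop :=
  ∃ c, c ∉ T ∧ (∃ c₁ ∈ T, ∃ c₂ ∈ T, IsResolvent c₁ c₂ c) ∧ T' = T ∪ {c}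

theorem exists_derivation_of_reflTransGen {T' : Set (RClause L A)}
    (h : Relation.ReflTransGen Extends S T') :
    ∃ (n : ℕ) (T : ℕ → Set (RClause L A)), IsDerivation S n T ∧ T n = T' := by
  induction h with
  | refl => exact ⟨0, fun _ => S, ⟨rfl, fun i hi => absurd hi (by simp)⟩, rfl⟩
  | @tail T₁ T₂ _ h12 ih =>
    obtain ⟨n, T, hT, rfl⟩ := ih
    -- The stages beyond `n + 1` are irrelevant and are filled with `T₂`.
    refine ⟨n + 1, fun i => if i ≤ n then T i else T₂, ⟨by simpa using hT.zero, fun i hi => ?_⟩,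
      by simp⟩
    have hi' : i < n + 1 := by exact_mod_cast hi
    rcases Nat.lt_succ_iff_lt_or_eq.1 hi' with hlt | rfl
    · simp only [hlt.le, Nat.succ_le_of_lt hlt, if_true]
      exact hT.step i (by exact_mod_cast hlt)
    · simp only [le_refl, Nat.not_succ_le_self, if_true, if_false]
      exact h12

/-- The clauses derivable from `S` by resolution. -/
inductive Derivable (S : Set (RClause L A)) : RClause L A → Prop
  | base {c} : c ∈ S → Derivable S c
  | step {c₁ c₂ c} : Derivable S c₁ → Derivable S c₂ → IsResolvent c₁ c₂ c → Derivable S c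

theorem subset_of_reflTransGen {T T' : Set (RClause L A)} (h : Relation.ReflTransGen Extends T T') :
    T ⊆ T' := by
  induction h with
  | refl => exact subset_rfl
  | tail _ h ih =>
    obtain ⟨c, -, -, rfl⟩ := h
    exact ih.trans Set.subset_union_left

/-- A derivation tree is linearised. Allowing an arbitrary start `T ⊇ S` lets the second premise be
derived on top of the first. -/
theorem Derivable.exists_stage {c : RClause L A} (h : Derivable S c) :
    ∀ T, S ⊆ T → ∃ T', Relation.ReflTransGen Extends T T' ∧ c ∈ T' := by
  induction h with
  | base hc => exact fun T hT => ⟨T, .refl, hT hc⟩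
  | @step c₁ c₂ c _ _ hr ih₁ ih₂ =>
    intro T hT
    obtain ⟨T₁, h₁, hc₁⟩ := ih₁ T hT
    obtain ⟨T₂, h₂, hc₂⟩ := ih₂ T₁ (hT.trans (subset_of_reflTransGen h₁))
    -- A step must add a new clause, so none is made if `c` is already present.
    by_cases hc : c ∈ T₂
    · exact ⟨T₂, h₁.trans h₂, hc⟩
    · exact ⟨T₂ ∪ {c}, (h₁.trans h₂).tail
        ⟨c, hc, ⟨c₁, subset_of_reflTransGen h₂ hc₁, c₂, hc₂, hr⟩, rfl⟩, by simp⟩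

end Derivations

/-! ### Lifting -/

section Lifting

open Classical in
/-- A literal of an instance of `C` is lifted to a literal of a factor of `C` whose other literals
have other instances; the variables of the factor are in the range of `f`. -/
theorem exists_factor {C : Clause L A} {t : Sub L} {l : Literal L A} (hl : l ∈ C.subst t)
    {f : ℕ → ℕ} (hf : f.Injective) :
    ∃ (F : Clause L A) (k : Literal L A) (r : Sub L), IsFactor F C ∧ k ∈ F ∧ k.subst r = l ∧
      Clause.subst (F.erase k) r ⊆ (C.subst t).erase l ∧ F.vars ⊆ Set.range f := by
  -- All literals that `t` sends to `l` are merged, so that no other literal of the factor is sent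
  -- to `l`.
  set K := C.filter fun k => k.subst t = l
  set U : Sub L → Prop := fun t => ∀ k ∈ K, ∀ k' ∈ K, k.subst t = k'.subst t with hU
  have mem_K : ∀ {k}, k ∈ K ↔ k ∈ C ∧ k.subst t = l := Finset.mem_filter
  have hexp : ∀ k ∈ K, k.exponent = l.exponent := fun k hk => by
    rw [← (mem_K.1 hk).2]; rfl
  have hUt : U t := fun k hk k' hk' => (mem_K.1 hk).2.trans (mem_K.1 hk').2.symm
  obtain ⟨s₀, hs₀⟩ : ∃ s, IsMostGeneral U s := by
    -- All exponents in `K` agree, so unifying the literals amounts to unifying all pairs of their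
    -- atoms.
    obtain ⟨s, hs⟩ := exists_mgu_atoms
      ((K ×ˢ K).toList.map fun p => (p.1.atom, p.2.atom)) (t₀ := t) (by
        simp only [List.forall_mem_map, Finset.mem_toList, Finset.mem_product]
        exact fun p hp => congrArg Literal.atom (hUt _ hp.1 _ hp.2))
    refine ⟨s, hs.congr fun t => ?_⟩
    simp only [List.forall_mem_map, Finset.mem_toList, Finset.mem_product, hU, Prod.forall]
    refine ⟨fun h k hk k' hk' => Literal.ext (h k k' ⟨hk, hk'⟩) ?_,
      fun h k k' hk => congrArg Literal.atom (h k hk.1 k' hk.2)⟩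
    exact (hexp k hk).trans (hexp k' hk').symm
  have hs := hs₀.rename (fun t r ht k hk k' hk' => by
    rw [← literal_subst_subst, ← literal_subst_subst, ht k hk k' hk']) hf
  set s := s₀.comp (Sub.rename L f) with hs_def
  obtain ⟨r, hr⟩ := hs.2 t hUt
  obtain rfl : t = s.comp r := funext hr
  obtain ⟨k, hkC, hkl⟩ := clause_mem_subst.1 hl
  have hkK : k ∈ K := mem_K.2 ⟨hkC, hkl⟩
  refine ⟨C.subst s, k.subst s, r, ⟨K, Finset.filter_subset _ _, s, hs, rfl⟩,
    clause_mem_subst.2 ⟨k, hkC, rfl⟩, by rw [literal_subst_subst, hkl], ?_, ?_⟩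
  · intro m hm
    obtain ⟨m', hm', rfl⟩ := clause_mem_subst.1 hm
    rw [Finset.mem_erase] at hm'
    obtain ⟨hne, hm'⟩ := hm'
    obtain ⟨q, hq, rfl⟩ := clause_mem_subst.1 hm'
    rw [literal_subst_subst, Finset.mem_erase]
    refine ⟨fun he => hne ?_, clause_mem_subst.2 ⟨q, hq, rfl⟩⟩
    -- A literal `q` sent to `l` lies in `K`, hence `s` has identified it with `k`.
    exact hs.1 q (mem_K.2 ⟨hq, he⟩) k hkK
  · rintro n ⟨m, hm, i, hn⟩
    obtain ⟨q, hq, rfl⟩ := clause_mem_subst.1 hm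
    have h := term_subst_subst (q.atom.args i) s₀ (Sub.rename L f)
    exact varFinset_subst_rename (t := (q.atom.args i).subst s₀) (by rw [h]; exact hn)

open Classical in
/-- A resolvent of instances of two clauses is, up to subsumption, an instance of a resolvent. -/
theorem exists_resolvent {c₁ c₂ : RClause L A} {t₁ t₂ : Sub L} {l₁ l₂ : Literal L A}
    (h₁ : l₁ ∈ c₁.1.subst t₁) (h₂ : l₂ ∈ c₂.1.subst t₂) (ha : l₁.atom = l₂.atom)
    (ho : Opposite l₁.exponent l₂.exponent) :
    ∃ (c : RClause L A) (t : Sub L), IsResolvent c₁ c₂ c ∧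
      c.1.subst t ⊆ (c₁.1.subst t₁).erase l₁ ∪ (c₂.1.subst t₂).erase l₂ := by
  -- Even variables for one factor and odd ones for the other: the factors are variable-disjoint,
  -- and `r₁`, `r₂` glue to one substitution `r`.
  obtain ⟨F₁, k₁, r₁, hF₁, hk₁, rfl, hs₁, hv₁⟩ :=
    exists_factor h₁ (f := fun n => 2 * n) (fun a b h => by simpa using h)
  obtain ⟨F₂, k₂, r₂, hF₂, hk₂, rfl, hs₂, hv₂⟩ :=
    exists_factor h₂ (f := fun n => 2 * n + 1) (fun a b h => by simpa using h)
  let r : Sub L := fun n => if Even n then r₁ n else r₂ n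
  have e₁ : ∀ k ∈ F₁, k.subst r = k.subst r₁ := fun k hk => literal_subst_congr hk fun n hn => by
    obtain ⟨m, rfl⟩ := hv₁ hn
    simp [r]
  have e₂ : ∀ k ∈ F₂, k.subst r = k.subst r₂ := fun k hk => literal_subst_congr hk fun n hn => by
    obtain ⟨m, rfl⟩ := hv₂ hn
    simp [r]
  have hdisj : Disjoint F₁.vars F₂.vars := by
    refine Set.disjoint_of_subset hv₁ hv₂ (Set.disjoint_left.2 ?_)
    rintro _ ⟨m, rfl⟩ ⟨n, hn⟩
    simp only at hn
    omega
  have hr : k₁.atom.subst r = k₂.atom.subst r := by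
    rw [← e₁ _ hk₁, ← e₂ _ hk₂] at ha
    exact ha
  obtain ⟨s, hs⟩ := exists_mgu_atoms [(k₁.atom, k₂.atom)] (t₀ := r) (by simpa using hr)
  replace hs := hs.congr (V := fun t => k₁.atom.subst t = k₂.atom.subst t) fun t => by simp
  obtain ⟨d, hd⟩ := hs.2 r hr
  have hsd : s.comp d = r := (funext hd).symm
  refine ⟨(Clause.subst (F₁.erase k₁) s ∪ Clause.subst (F₂.erase k₂) s,
    reliability c₁.2 c₂.2 k₁.exponent k₂.exponent), d,
    ⟨F₁, F₂, hF₁, hF₂, hdisj, k₁, hk₁, k₂, hk₂, s, ho.1, ho.2, hs, rfl, rfl⟩, ?_⟩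
  intro l hl
  obtain ⟨k, hk, rfl⟩ := clause_mem_subst.1 hl
  rcases Finset.mem_union.1 hk with hk | hk <;> obtain ⟨q, hq, rfl⟩ := clause_mem_subst.1 hk <;>
    rw [literal_subst_subst, hsd]
  · rw [e₁ _ (Finset.mem_of_mem_erase hq)]
    exact Finset.mem_union_left _ (hs₁ (clause_mem_subst.2 ⟨q, hq, rfl⟩))
  · rw [e₂ _ (Finset.mem_of_mem_erase hq)]
    exact Finset.mem_union_right _ (hs₂ (clause_mem_subst.2 ⟨q, hq, rfl⟩))

end Lifting

/-! ### Completeness -/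

section Completeness

open Classical in
/-- Completeness of propositional resolution: a set `G` of clauses that is closed under
weakening and cuts, and does not contain the empty clause, is satisfied by a valuation of the
atoms. -/
theorem exists_valuation {G : Set (Clause L A)} (hG : ∀ D ∈ G, ∀ D', D ⊆ D' → D' ∈ G)
    (cut : ∀ (D : Clause L A) (l₁ l₂ : Literal L A), l₁.atom = l₂.atom → Value.mid < l₁.exponent →
      l₂.exponent < Value.mid → insert l₁ D ∈ G → insert l₂ D ∈ G → D ∈ G)
    (hE : ∅ ∉ G) :
    ∃ V : Set (Atom L), ∀ D ∈ G, Proper D → ∃ l ∈ D, l.atom ∈ V ↔ Value.mid < l.exponent := by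
  -- Clauses are finite, so including no member of `G` is a property of finite character and a
  -- maximal such `M` exists. The literals of `M` are to contain all false ones.
  have hfin : Order.IsOfFiniteCharacter
      {M : Set (Literal L A) | ∀ D : Clause L A, (D : Set (Literal L A)) ⊆ M → D ∉ G} := by
    intro M
    refine ⟨fun h N hN _ D hD => h D (hD.trans hN), fun h D hD => ?_⟩
    exact h D hD D.finite_toSet D subset_rfl
  obtain ⟨M, -, hM⟩ := hfin.exists_maximal (x := ∅) (fun D hD => by
    obtain rfl : D = ∅ := by simpa using hD
    exact hE)
  have hout : ∀ l ∉ M, ∃ D : Clause L A, (D : Set (Literal L A)) ⊆ M ∧ insert l D ∈ G := by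
    intro l hl
    have h : insert l M ∉ {M : Set (Literal L A) | ∀ D : Clause L A,
        (D : Set (Literal L A)) ⊆ M → D ∉ G} := fun h =>
      hl (hM.le_of_ge h (Set.subset_insert l M) (Set.mem_insert l M))
    simp only [Set.mem_ofPred_eq, not_forall, not_not] at h
    obtain ⟨D, hD, hDG⟩ := h
    refine ⟨D.erase l, ?_, hG D hDG _ (Finset.subset_insert_iff.2 subset_rfl)⟩
    rw [Finset.coe_erase, Set.sdiff_singleton_subset_iff]
    exact hD
  -- If both complementary literals were missing from `M`, a cut would give a member of `G` inside
  -- `M`.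
  have hor : ∀ l₁ l₂ : Literal L A, l₁.atom = l₂.atom → Value.mid < l₁.exponent →
      l₂.exponent < Value.mid → l₁ ∈ M ∨ l₂ ∈ M := by
    intro l₁ l₂ ha hp hn
    by_contra! hc
    obtain ⟨D₁, hD₁, h₁⟩ := hout l₁ hc.1
    obtain ⟨D₂, hD₂, h₂⟩ := hout l₂ hc.2
    refine hM.prop (D₁ ∪ D₂) (by simp [hD₁, hD₂]) (cut _ l₁ l₂ ha hp hn
      (hG _ h₁ _ (Finset.insert_subset_insert _ Finset.subset_union_left))
      (hG _ h₂ _ (Finset.insert_subset_insert _ Finset.subset_union_right)))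
  -- An atom carries many literals on each side of `W`. It is made true if all its negative literals
  -- lie in `M`; otherwise `hor` puts all its positive literals into `M`. Either way every false
  -- proper literal lies in `M`, so a falsified proper clause would be included in `M`.
  refine ⟨{P | ∀ l : Literal L A, l.atom = P → l.exponent < Value.mid → l ∈ M},
    fun D hD hDp => ?_⟩
  by_contra! hc
  refine hM.prop D (fun l hl => ?_) hD
  rcases (hDp l hl).lt_or_gt with hlt | hgt
  · rcases hc l hl with h | h
    · exact h.1 l rfl hlt
    · exact absurd h.2 hlt.not_gt
  · rcases hc l hl with h | h
    · exact absurd hgt h.2.not_gt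
    · have h1 := h.1
      simp only [Set.mem_ofPred_eq, not_forall] at h1
      obtain ⟨l', ha, hn, hl'⟩ := h1
      exact (hor l l' ha.symm hgt hn).resolve_right hl'

open Classical in
/-- The interpretation on the set of all terms in which the atoms of `V` are true. -/
noncomputable def herbrand (V : Set (Atom L)) :
    Interpretation.{u, v, max u w} L A (ULift.{w} (L.Term ℕ)) where
  func f ts := ⟨.func f fun i => (ts i).down⟩
  pred {n} P ts := if (⟨n, P, fun i => (ts i).down⟩ : Atom L) ∈ V then ⊤ else ⊥
  pred_ne_mid P ts := by
    split_ifs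
    · exact mid_lt_top.ne'
    · exact bot_lt_mid.ne

theorem herbrand_term (V : Set (Atom L)) (e : ℕ → ULift.{w} (L.Term ℕ)) (t : L.Term ℕ) :
    ((herbrand V : Interpretation L A _).term e t).down = t.subst fun n => (e n).down := by
  induction t with
  | var n => rfl
  | func f ts ih =>
    simp only [Interpretation.term, herbrand, Term.subst]
    congr 1
    funext i
    exact ih i

/-- Assignments in the term domain are substitutions, so truth of a clause under all assignments
reduces to truth of its instances under `V`. -/
theorem mid_lt_herbrand_atom (V : Set (Atom L)) (e : ℕ → ULift.{w} (L.Term ℕ)) (P : Atom L) :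
    Value.mid < (herbrand V : Interpretation L A _).atom e P ↔
      P.subst (fun n => (e n).down) ∈ V := by
  have h : (⟨P.arity, P.pred, fun i => ((herbrand V : Interpretation L A _).term e (P.args i)).down⟩
      : Atom L) = P.subst fun n => (e n).down := by
    simp only [herbrand_term, Atom.subst]
  rw [← h]
  simp only [Interpretation.atom]
  conv_lhs => simp only [herbrand]
  split_ifs with hV
  · exact iff_of_true mid_lt_top hV
  · exact iff_of_false bot_lt_mid.not_gt hV

open Classical in
/-- A clause set that is closed under resolution up to renaming, and does not contain the empty
clause, is satisfiable. -/
theorem exists_empty_of_unsatisfiable {S : Set (RClause L A)} (hS : ∀ c ∈ S, Proper c.1)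
    (closed : ∀ c₁ ∈ S, ∀ c₂ ∈ S, ∀ c, IsResolvent c₁ c₂ c → ∃ c' ∈ S, IsVariant c'.1 c.1)
    (hU : Unsatisfiable.{u, v, w} S) : ∃ r : Value A, ((∅ : Clause L A), r) ∈ S := by
  by_contra! hE
  obtain ⟨V, hV⟩ := exists_valuation
    (G := {D : Clause L A | ∃ c ∈ S, ∃ t : Sub L, c.1.subst t ⊆ D})
    (by
      rintro D ⟨c, hc, t, ht⟩ D' hD'
      exact ⟨c, hc, t, ht.trans hD'⟩)
    (by
      rintro D l₁ l₂ ha hp hn ⟨c₁, hc₁, t₁, ht₁⟩ ⟨c₂, hc₂, t₂, ht₂⟩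
      -- If the cut literal is absent from one of the instances, that instance is already included
      -- in `D`.
      by_cases h₁ : l₁ ∈ c₁.1.subst t₁
      · by_cases h₂ : l₂ ∈ c₂.1.subst t₂
        · obtain ⟨c, t, hc, ht⟩ := exists_resolvent h₁ h₂ ha
            ((opposite_iff hp.ne' hn.ne).2 (by simp [hp, hn.not_gt]))
          obtain ⟨c', hc', p, hp'⟩ := closed c₁ hc₁ c₂ hc₂ c hc
          -- Undoing the renaming `p` first makes the instance of the resolvent an instance of its
          -- variant.
          refine ⟨c', hc', fun n => t (p.symm n), ?_⟩
          rw [hp', clause_subst_subst]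
          have : (Sub.comp (fun n => .var (p n)) fun n => t (p.symm n)) = t := by
            funext n
            simp [Sub.comp, Term.subst]
          rw [this]
          refine ht.trans (Finset.union_subset ?_ ?_)
          · exact Finset.subset_insert_iff.1 ht₁
          · exact Finset.subset_insert_iff.1 ht₂
        · exact ⟨c₂, hc₂, t₂, (Finset.subset_insert_iff_of_notMem h₂).1 ht₂⟩
      · exact ⟨c₁, hc₁, t₁, (Finset.subset_insert_iff_of_notMem h₁).1 ht₁⟩)
    (by
      rintro ⟨⟨C, r⟩, hc, t, ht⟩
      refine hE r ?_
      have : C = ∅ := by simpa [Clause.subst] using ht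
      rwa [this] at hc)
  refine hU (ULift.{w} (L.Term ℕ)) (herbrand V) fun c hc e => ?_
  obtain ⟨l, hl, hlV⟩ := hV (c.1.subst fun n => (e n).down) ⟨c, hc, _, subset_rfl⟩
    ((hS c hc).subst _)
  obtain ⟨k, hk, rfl⟩ := clause_mem_subst.1 hl
  refine (mid_le_clause _).2 ⟨k, hk, (mid_le_literal _ (hS c hc k hk)).2 ?_⟩
  rw [mid_lt_herbrand_atom]
  exact hlV

theorem isVariant_refl (C : Clause L A) : IsVariant C C :=
  ⟨1, by
    ext l
    have : ∀ k : Literal L A, k.subst (fun n => .var ((1 : Equiv.Perm ℕ) n)) = k := fun k =>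
      Literal.ext (by
        simp only [Literal.subst, Atom.subst, Equiv.Perm.coe_one, id]
        congr
        funext i
        exact term_subst_var _) rfl
    simp only [clause_mem_subst, this, exists_eq_right]⟩

end Completeness

end LingLogic

/-! ### Soundness and completeness of linguistic resolution -/

theorem mainTheorem1 {X : Type x} {H : Type y} [PartialOrder X] (A : LinHA X H)
    (L : FirstOrder.Language.{u, v}) (S : Set (LingLogic.RClause L A))
    (hrel : ∀ c ∈ S, LinHA.Value.mid < c.2)
    (hexp : ∀ c ∈ S, ∀ l ∈ c.1, l.exponent ≠ LinHA.Value.mid) :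
    (LingLogic.Unsatisfiable.{u, v, w} S ↔
      ∃ (len : ℕ∞) (T : ℕ → Set (LingLogic.RClause L A)),
        LingLogic.IsDerivation S len T ∧ LingLogic.ReachesEmpty len T) ∧
    (∀ (len : ℕ∞) (T : ℕ → Set (LingLogic.RClause L A)),
      LingLogic.IsDerivation S len T → LingLogic.IsExhaustive len T →
      (LingLogic.Unsatisfiable.{u, v, w} S ↔ LingLogic.ReachesEmpty len T)) := by
  have mono : ∀ S' : Set (LingLogic.RClause L A), S ⊆ S' → LingLogic.Unsatisfiable.{u, v, w} S →
      LingLogic.Unsatisfiable.{u, v, w} S' := fun S' hS hU D _ I hI =>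
    hU D I fun c hc => hI c (hS hc)
  refine ⟨⟨fun hU => ?_, ?_⟩, fun len T hT hex => ⟨fun hU => ?_, hT.unsatisfiable hexp⟩⟩
  · obtain ⟨r, hr⟩ := LingLogic.exists_empty_of_unsatisfiable
      (S := {c | LingLogic.Derivable S c})
      (fun c hc => by
        induction hc with
        | base hc => exact hexp _ hc
        | step _ _ hr ih₁ ih₂ => exact hr.proper ih₁ ih₂)
      (fun c₁ h₁ c₂ h₂ c hc => ⟨c, LingLogic.Derivable.step h₁ h₂ hc, LingLogic.isVariant_refl _⟩)
      (mono _ (fun c hc => LingLogic.Derivable.base hc) hU)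
    obtain ⟨T', hT', hrT⟩ := hr.exists_stage S subset_rfl
    obtain ⟨n, T, hT, rfl⟩ := LingLogic.exists_derivation_of_reflTransGen hT'
    exact ⟨n, T, hT, n, le_rfl, r, hrT⟩
  · rintro ⟨len, T, hT, hE⟩
    exact hT.unsatisfiable hexp hE
  -- The union of the stages is closed up to renaming: premises from stages `i` and `j` both occur
  -- in stage `max i j`, where exhaustiveness applies.
  · obtain ⟨r, i, hi, hr⟩ := LingLogic.exists_empty_of_unsatisfiable
      (S := {c | ∃ i : ℕ, (i : ℕ∞) ≤ len ∧ c ∈ T i})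
      (fun c ⟨i, hi, hc⟩ => hT.induction (p := fun c => LingLogic.Proper c.1) hexp
        (fun _ _ _ p₁ p₂ hr => hr.proper p₁ p₂) hi c hc)
      (by
        rintro c₁ ⟨i, hi, h₁⟩ c₂ ⟨j, hj, h₂⟩ c hc
        have hm : ((max i j : ℕ) : ℕ∞) ≤ len := by
          rcases max_choice i j with h | h <;> rwa [h]
        obtain ⟨k, hk, c', hc', hv⟩ := hex (max i j) hm c₁ (hT.mono (le_max_left i j) hm h₁)
          c₂ (hT.mono (le_max_right i j) hm h₂) c hc
        exact ⟨c', ⟨k, hk, hc'⟩, hv⟩)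
      (mono _ (fun c hc => ⟨0, by simp, hT.zero ▸ hc⟩) hU)
    exact ⟨i, hi, r, hr⟩
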